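/- Let $\mathsf X$ be a Polish space with its Borel $\sigma$-algebra. Let $V:\mathsf X\to[1,\infty)$ be measurable and unbounded, put $v=e^V$ and $C_d=\{x: V(x)\le d\}$, write $\eta(\varphi)=\int\varphi\,d\eta$, let $\mathcal P_v$ be the set of probability measures $\eta$ on $\mathsf X$ with $\eta(v)<\infty$, and for a signed measure $s$ let $\|s\|_v=\sup\{s(\varphi):\varphi \text{ measurable},\ |\varphi|\le v\}$. Fix $\delta>0$, $\underline d\ge 1$ and, for every $d\ge\underline d$, real numbers $b_d$ and $0<\epsilon_d^-\le\epsilon_d^+<\infty$ and a measure $\nu_d\in\mathcal P_v$ with $\nu_d(C_r)>0$ for all $r\in[\underline d,d]$. Let $\mu\in\mathcal P_v$. Consider Markov kernels $(M_n)_{n\ge1}$ on $\mathsf X$ and strictly positive measurable functions $(G_n)_{n\ge0}$ on $\mathsf X$, put $Q_n(x,dx')=G_{n-1}(x)M_n(x,dx')$ and $Q_{0,n}=Q_1\cdots Q_n$ ($Q_{0,0}=\mathrm{Id}$), and for a probability measure $\mu$ let $\eta_n^{(\mu)}=\mu Q_{0,n}/\mu Q_{0,n}(1)$. Call $(M_n,G_n)$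 admissible if for all $n\ge1$ and $d\ge\underline d$: (a) $Q_n(e^V)(x)\le \exp\big(V(x)(1-\delta)+b_d\mathbb 1_{C_d}(x)\big)$ for all $x\in\mathsf X$; (b) $Q_n(x,C_d)>0$ for all $x\in\mathsf X$, and $Q_n(x,C_d\cap A)\ge\epsilon_d^-\nu_d(C_d\cap A)$ for all $x\in C_d$ and Borel $A$; (c) $Q_n(x,C_d\cap A)\le\epsilon_d^+\nu_d(C_d\cap A)$ for all $x\in C_d$ and Borel $A$. Then there is $\rho\in[0,1)$, depending only on $\mu$ and on $V,\delta,\underline d,(b_d),(\epsilon_d^\pm),(\nu_d)$, such that for every $\mu'\in\mathcal P_v$ there is $c_{\mu,\mu'}<\infty$, depending only on the same quantities and on $\mu'$, such that for every admissible $(M_n,G_n)$ and all $n\ge0$ $$\big\|\eta_n^{(\mu)}-\eta_n^{(\mu')}\big\|_v\le\rho^n\,c_{\mu,\mu'}\,\mu(v)\,\mu'(v).$$ -/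

import Mathlib

open MeasureTheory ProbabilityTheory
open scoped ENNReal NNReal

/-- The data of a (non-homogeneous) Feynman--Kac model on `X`: Markov kernels and strictly positive,
real-valued, measurable potential functions.  `M n` is the kernel of the transition from time `n`
to time `n + 1`, i.e. the kernel usually written `M_{n+1}`; `G n` is the potential `G_n`. -/
structure FeynmanKac (X : Type*) [MeasurableSpace X] where
  M : ℕ → Kernel X X
  G : ℕ → X → ℝ
  markov : ∀ n, IsMarkovKernel (M n)
  measurable_G : ∀ n, Measurable (G n)
  G_pos : ∀ n x, 0 < G n x

namespace FeynmanKac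

variable {X : Type*} [MeasurableSpace X]

/-- `F.Q n` is the kernel `Q_{n+1}(x, dx') = G_n(x) M_{n+1}(x, dx')`, so that the family
`(F.Q n)_{n ≥ 0}` is the family `(Q_n)_{n ≥ 1}`. -/
noncomputable def Q (F : FeynmanKac X) (n : ℕ) : Kernel X X where
  toFun x := ENNReal.ofReal (F.G n x) • F.M n x
  measurable' := by
    refine Measure.measurable_of_measurable_coe _ fun s hs => ?_
    simp only [Measure.smul_apply, smul_eq_mul]
    exact (F.measurable_G n).ennreal_ofReal.mul ((F.M n).measurable_coe hs)

/-- `F.Q0 n` is the kernel `Q_{0,n} = Q_1 Q_2 ⋯ Q_n` (with `Q_{0,0} = Id`). -/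
noncomputable def Q0 (F : FeynmanKac X) : ℕ → Kernel X X
  | 0 => Kernel.id
  | n + 1 => (F.Q n).comp (Q0 F n)

/-- The unnormalised measure `γ_n = μ Q_{0,n}`. -/
noncomputable def gamma (F : FeynmanKac X) (μ : Measure X) (n : ℕ) : Measure X :=
  μ.bind (F.Q0 n)

/-- The normalised (predictive) measure `η_n = μ Q_{0,n} / μ Q_{0,n}(1)` started from `μ`. -/
noncomputable def eta (F : FeynmanKac X) (μ : Measure X) (n : ℕ) : Measure X :=
  (F.gamma μ n Set.univ)⁻¹ • F.gamma μ n

instance isFiniteMeasure_eta (F : FeynmanKac X) (μ : Measure X) (n : ℕ) :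
    IsFiniteMeasure (F.eta μ n) :=
  ⟨by
    simp only [eta, Measure.smul_apply, smul_eq_mul]
    exact lt_of_le_of_lt (ENNReal.inv_mul_le_one _) ENNReal.one_lt_top⟩

end FeynmanKac

section Weighted

variable {X : Type*} [MeasurableSpace X]

/-- `integralExp V η = η(v) = ∫ v dη` for `v = e^V`, as an extended nonnegative real. -/
noncomputable def integralExp (V : X → ℝ) (η : Measure X) : ℝ≥0∞ :=
  ∫⁻ x, ENNReal.ofReal (Real.exp (V x)) ∂η

/-- `η ∈ 𝒫_v` for `v = e^V`: `η` is a probability measure with `η(v) < ∞`. -/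
def MemP (V : X → ℝ) (η : Measure X) : Prop :=
  IsProbabilityMeasure η ∧ integralExp V η < ∞

/-- The `v`-norm of a signed measure, for `v = e^V`: the supremum of `s(φ) = ∫ φ ds` over all
measurable `φ : X → ℝ` with `|φ| ≤ v`. -/
noncomputable def vNorm (V : X → ℝ) (s : SignedMeasure X) : ℝ≥0∞ :=
  ⨆ φ : {φ : X → ℝ // Measurable φ ∧ ∀ x, |φ x| ≤ Real.exp (V x)},
    ENNReal.ofReal (∫ᵛ x, φ.1 x ∂<•s)

/-- The sublevel set `C_d = {x : V x ≤ d}`. -/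
def sublevel (V : X → ℝ) (d : ℝ) : Set X := {x | V x ≤ d}

/-- The multiplicative drift condition, for the given `V`, `δ`, `dlow` and
`d ↦ b d` (only the values `b d` with `d ≥ dlow` matter). -/
structure DriftCondition (F : FeynmanKac X) (V : X → ℝ) (δ dlow : ℝ) (b : ℝ → ℝ) : Prop where
  measurable_V : Measurable V
  one_le_V : ∀ x, 1 ≤ V x
  unbounded_V : ¬ BddAbove (Set.range V)
  delta_pos : 0 < δ
  one_le_dlow : 1 ≤ dlow
  drift : ∀ d, dlow ≤ d → ∀ n x, integralExp V (F.Q n x) ≤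
    ENNReal.ofReal (Real.exp (V x * (1 - δ) + (sublevel V d).indicator (fun _ => b d) x))

/-- The condition on the initial law: `μ ∈ 𝒫_v`. -/
def InitialCondition (V : X → ℝ) (μ : Measure X) : Prop := MemP V μ

/-- The local minorization condition, for the given `d ↦ εm d` (that is `ε_d⁻`)
and `d ↦ ν d`. -/
structure MinorizationCondition (F : FeynmanKac X) (V : X → ℝ) (dlow : ℝ) (εm : ℝ → ℝ) (ν : ℝ → Measure X) :
    Prop where
  accessible : ∀ d, dlow ≤ d → ∀ n x, 0 < F.Q n x (sublevel V d)
  eps_pos : ∀ d, dlow ≤ d → 0 < εm d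
  nu_mem : ∀ d, dlow ≤ d → MemP V (ν d)
  minorization : ∀ d, dlow ≤ d → ∀ n, ∀ x ∈ sublevel V d, ∀ A, MeasurableSet A →
    ENNReal.ofReal (εm d) * ν d (sublevel V d ∩ A) ≤ F.Q n x (sublevel V d ∩ A)
  nu_pos : ∀ d, dlow ≤ d → ∀ r, dlow ≤ r → r ≤ d → 0 < ν d (sublevel V r)

/-- The local majorization condition, for the given `d ↦ εp d` (that is `ε_d⁺`),
with `ε_d⁻` and `ν_d` as in the minorization condition. -/
structure MajorizationCondition (F : FeynmanKac X) (V : X → ℝ) (dlow : ℝ) (εm εp : ℝ → ℝ) (ν : ℝ → Measure X) :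
    Prop where
  eps_le : ∀ d, dlow ≤ d → εm d ≤ εp d
  majorization : ∀ d, dlow ≤ d → ∀ n, ∀ x ∈ sublevel V d, ∀ A, MeasurableSet A →
    F.Q n x (sublevel V d ∩ A) ≤ ENNReal.ofReal (εp d) * ν d (sublevel V d ∩ A)

end Weighted

/-!
Write `u = Q_{0,n} v` and `D_n(x, y) = Q_{0,n} f(x) Q_{0,n} 1(y) - Q_{0,n} 1(x) Q_{0,n} f(y)` for
`|f| ≤ v`; then `η_n(f) - η'_n(f)` is the integral of `D_n` against `μ ⊗ μ'`, divided by
`γ_n(1) γ'_n(1)`. The function `D_n` is obtained by iterating the product kernels `Q ⊗ Q` on an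
antisymmetric function. Antisymmetric functions integrate to zero against `ν ⊗ ν`, so each
transition between two pairs of `C_d × C_d`, where `Q ⊗ Q` is comparable with `ν ⊗ ν`, gains a
factor `w < 1`. A pair outside `C_d × C_d` instead gains `θ = e^{-δd}` from the drift. A trajectory
with at most `J` pairs outside has at least `n - 1 - 2J` good transitions, whence
`|D_n| ≤ 2 (w^{n-1-2J} u ⊗ u + θ^J e^{2Bn} v ⊗ v)`. After integration the first term is
`w^{n-1-2J} γ_n(v) γ'_n(v)`, and `γ_n(v) ≤ C γ_n(1)`. The second is controlled because
`γ_n(1) ≥ c l^n` with `l` independent of `d`: for `J = n / 4` and `d` large, `θ^{1/4}` beats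
`e^{2B} / l²`.
-/

section ProductMeasures

variable {X : Type*} [MeasurableSpace X]

lemma integral_prod_self_eq_zero_of_antisymm {ν : Measure X} [SFinite ν] {D : X × X → ℝ}
    (hanti : ∀ z, D z.swap = -D z) : ∫ z, D z ∂ν.prod ν = 0 := by
  have hswap := integral_prod_swap (μ := ν) (ν := ν) D
  simp only [hanti, integral_neg] at hswap
  linarith

lemma abs_integral_le_of_le_of_le_smul {P N : Measure X} [IsFiniteMeasure P] {r : ℝ}
    (hr : 0 < r) (hNP : N ≤ P) (hPN : P ≤ ENNReal.ofReal r • N) {D : X → ℝ} (hD : Integrable D P)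
    (hzero : ∫ z, D z ∂N = 0) : |∫ z, D z ∂P| ≤ (1 - r⁻¹) * ∫ z, |D z| ∂P := by
  have := isFiniteMeasure_of_le _ hNP
  have hDN := hD.mono_measure hNP
  have hD_sub : Integrable D (P - N) := hD.mono_measure Measure.sub_le
  have hsub : P - N + N = P := Measure.sub_add_cancel_of_le hNP
  have hintegral : ∫ z, D z ∂P = ∫ z, D z ∂(P - N) := by
    conv_lhs => rw [← hsub]
    rw [integral_add_measure hD_sub hDN, hzero, add_zero]
  have habs : ∫ z, |D z| ∂P = ∫ z, |D z| ∂(P - N) + ∫ z, |D z| ∂N := by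
    conv_lhs => rw [← hsub]
    exact integral_add_measure hD_sub.abs hDN.abs
  have hlower : r⁻¹ * ∫ z, |D z| ∂P ≤ ∫ z, |D z| ∂N := by
    rw [inv_mul_le_iff₀ hr]
    have := integral_mono_measure hPN (Filter.Eventually.of_forall fun z => abs_nonneg (D z))
      (hDN.abs.smul_measure ENNReal.ofReal_ne_top)
    rwa [integral_smul_measure, ENNReal.toReal_ofReal hr.le] at this
  calc |∫ z, D z ∂P| ≤ ∫ z, |D z| ∂(P - N) := hintegral ▸ abs_integral_le_integral_abs
    _ ≤ (1 - r⁻¹) * ∫ z, |D z| ∂P := by linarith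

lemma abs_integral_prod_le_of_antisymm {α β ν : Measure X} [IsFiniteMeasure α]
    [IsFiniteMeasure β] [SFinite ν] {e₁ e₂ : ℝ} (he₁ : 0 < e₁) (he₂ : 0 < e₂)
    (hα₁ : ENNReal.ofReal e₁ • ν ≤ α) (hα₂ : α ≤ ENNReal.ofReal e₂ • ν)
    (hβ₁ : ENNReal.ofReal e₁ • ν ≤ β) (hβ₂ : β ≤ ENNReal.ofReal e₂ • ν)
    {D : X × X → ℝ} (hD : Integrable D (α.prod β)) (hanti : ∀ z, D z.swap = -D z) :
    |∫ z, D z ∂α.prod β| ≤ (1 - (e₁ / e₂) ^ 2) * ∫ z, |D z| ∂α.prod β := by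
  have hsq {e : ℝ} (he : 0 < e) : (ENNReal.ofReal e • ν).prod (ENNReal.ofReal e • ν) =
      ENNReal.ofReal (e ^ 2) • ν.prod ν := by
    rw [Measure.prod_smul_left, Measure.prod_smul_right, smul_smul, ← ENNReal.ofReal_mul he.le, sq]
  have hlower : ENNReal.ofReal (e₁ ^ 2) • ν.prod ν ≤ α.prod β :=
    hsq he₁ ▸ Measure.prod_mono hα₁ hβ₁
  have hupper : α.prod β ≤
      ENNReal.ofReal ((e₂ / e₁) ^ 2) • ENNReal.ofReal (e₁ ^ 2) • ν.prod ν := by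
    rw [smul_smul, ← ENNReal.ofReal_mul (by positivity), div_pow,
      div_mul_cancel₀ _ (by positivity), ← hsq he₂]
    exact Measure.prod_mono hα₂ hβ₂
  have hzero : ∫ z, D z ∂(ENNReal.ofReal (e₁ ^ 2) • ν.prod ν) = 0 := by
    rw [integral_smul_measure, integral_prod_self_eq_zero_of_antisymm hanti, smul_zero]
  simpa only [← inv_pow, inv_div] using
    abs_integral_le_of_le_of_le_smul (by positivity) hlower hupper hD hzero

lemma abs_integral_prod_le_of_antisymm_of_restrict {α β ν : Measure X} [IsFiniteMeasure α]
    [IsFiniteMeasure β] [SFinite ν] {C : Set X} (hC : MeasurableSet C) {e₁ e₂ w : ℝ}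
    (he₁ : 0 < e₁) (he₂ : 0 < e₂) (hw : 1 - (e₁ / e₂) ^ 2 ≤ w)
    (hα₁ : ENNReal.ofReal e₁ • ν.restrict C ≤ α.restrict C)
    (hα₂ : α.restrict C ≤ ENNReal.ofReal e₂ • ν.restrict C)
    (hβ₁ : ENNReal.ofReal e₁ • ν.restrict C ≤ β.restrict C)
    (hβ₂ : β.restrict C ≤ ENNReal.ofReal e₂ • ν.restrict C)
    {D h : X × X → ℝ} (hD : Integrable D (α.prod β)) (hanti : ∀ z, D z.swap = -D z)
    (hh : Integrable h (α.prod β)) (hin : ∀ z ∈ C ×ˢ C, w * |D z| ≤ h z)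
    (hout : ∀ z ∉ C ×ˢ C, |D z| ≤ h z) :
    |∫ z, D z ∂α.prod β| ≤ ∫ z, h z ∂α.prod β := by
  have hCC : MeasurableSet (C ×ˢ C) := hC.prod hC
  have hinside : |∫ z in C ×ˢ C, D z ∂α.prod β| ≤ ∫ z in C ×ˢ C, h z ∂α.prod β := by
    have hgain := abs_integral_prod_le_of_antisymm he₁ he₂ hα₁ hα₂ hβ₁ hβ₂
      (by rw [Measure.prod_restrict]; exact hD.restrict) hanti
    rw [Measure.prod_restrict] at hgain
    calc |∫ z in C ×ˢ C, D z ∂α.prod β|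
        ≤ w * ∫ z in C ×ˢ C, |D z| ∂α.prod β :=
          hgain.trans (mul_le_mul_of_nonneg_right hw (integral_nonneg fun z => abs_nonneg _))
      _ = ∫ z in C ×ˢ C, w * |D z| ∂α.prod β := (integral_const_mul _ _).symm
      _ ≤ ∫ z in C ×ˢ C, h z ∂α.prod β :=
          setIntegral_mono_on (hD.abs.const_mul w).integrableOn hh.integrableOn hCC hin
  have houtside : |∫ z in (C ×ˢ C)ᶜ, D z ∂α.prod β| ≤ ∫ z in (C ×ˢ C)ᶜ, h z ∂α.prod β :=
    abs_integral_le_integral_abs.trans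
      (setIntegral_mono_on hD.abs.integrableOn hh.integrableOn hCC.compl hout)
  rw [← integral_add_compl hCC hD, ← integral_add_compl hCC hh]
  exact (abs_add_le _ _).trans (add_le_add hinside houtside)

end ProductMeasures

section ExpWeight

variable {X : Type*} [MeasurableSpace X] {V : X → ℝ} {η η' : Measure X}

lemma measurableSet_sublevel (hV : Measurable V) (d : ℝ) : MeasurableSet (sublevel V d) :=
  measurableSet_le hV measurable_const

lemma exists_measure_sublevel_pos (V : X → ℝ) (η : Measure X) [NeZero η] (r : ℝ) :
    ∃ d, r ≤ d ∧ 0 < η (sublevel V d) := by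
  have hunion : ⋃ n : ℕ, sublevel V n = Set.univ :=
    Set.eq_univ_of_forall fun x => Set.mem_iUnion.2 (exists_nat_ge (V x))
  obtain ⟨n, hn⟩ : ∃ n : ℕ, 0 < η (sublevel V n) :=
    exists_measure_pos_of_not_measure_iUnion_null (by simp [hunion, NeZero.ne η])
  exact ⟨max r n, le_max_left _ _,
    hn.trans_le (measure_mono fun x (hx : V x ≤ n) => hx.trans (le_max_right _ _))⟩

lemma measure_univ_le_integralExp (hV0 : ∀ x, 0 ≤ V x) : η Set.univ ≤ integralExp V η := by
  rw [← lintegral_one, integralExp]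
  gcongr with x
  simpa using hV0 x

lemma isFiniteMeasure_of_integralExp_lt_top (hV0 : ∀ x, 0 ≤ V x) (hη : integralExp V η < ∞) :
    IsFiniteMeasure η :=
  ⟨(measure_univ_le_integralExp hV0).trans_lt hη⟩

lemma integrable_exp (hV : Measurable V) (hη : integralExp V η < ∞) :
    Integrable (fun x => Real.exp (V x)) η :=
  ⟨hV.exp.aestronglyMeasurable, (hasFiniteIntegral_iff_ofReal
    (Filter.Eventually.of_forall fun _ => (Real.exp_pos _).le)).2 hη⟩

lemma ofReal_integral_exp (hV : Measurable V) (hη : integralExp V η < ∞) :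
    ENNReal.ofReal (∫ x, Real.exp (V x) ∂η) = integralExp V η :=
  ofReal_integral_eq_lintegral_ofReal (integrable_exp hV hη)
    (Filter.Eventually.of_forall fun _ => (Real.exp_pos _).le)

/-- `f ∈ 𝓛_v` for `v = e^V`: `f` is measurable and bounded by a multiple of `v`. Such functions are
integrable against every measure with `η(v) < ∞`. -/
def ExpDominated (V f : X → ℝ) : Prop :=
  Measurable f ∧ ∃ K : ℝ, ∀ x, |f x| ≤ K * Real.exp (V x)

namespace ExpDominated

lemma of_abs_le_exp {f : X → ℝ} (hf : Measurable f) (hfv : ∀ x, |f x| ≤ Real.exp (V x)) :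
    ExpDominated V f :=
  ⟨hf, 1, by simpa using hfv⟩

lemma exp (hV : Measurable V) : ExpDominated V fun x => Real.exp (V x) :=
  of_abs_le_exp hV.exp (by simp)

lemma one (hV0 : ∀ x, 0 ≤ V x) : ExpDominated V fun _ => 1 :=
  of_abs_le_exp measurable_const (by simpa using hV0)

lemma integrable {f : X → ℝ} (hf : ExpDominated V f) (hV : Measurable V)
    (hη : integralExp V η < ∞) : Integrable f η := by
  obtain ⟨hfm, K, hK⟩ := hf
  exact ((integrable_exp hV hη).const_mul K).mono' hfm.aestronglyMeasurable
    (Filter.Eventually.of_forall hK)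

end ExpDominated

lemma vNorm_toSignedMeasure_sub_le (hV : Measurable V) [IsFiniteMeasure η] [IsFiniteMeasure η']
    (hη : integralExp V η < ∞) (hη' : integralExp V η' < ∞) {K : ℝ}
    (h : ∀ f : X → ℝ, Measurable f → (∀ x, |f x| ≤ Real.exp (V x)) →
      |∫ x, f x ∂η - ∫ x, f x ∂η'| ≤ K) :
    vNorm V (η.toSignedMeasure - η'.toSignedMeasure) ≤ ENNReal.ofReal K := by
  refine iSup_le fun ⟨f, hf, hfv⟩ => ENNReal.ofReal_le_ofReal ?_
  have hfd := ExpDominated.of_abs_le_exp hf hfv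
  rw [VectorMeasure.integral_sub_vectorMeasure, VectorMeasure.integral_toSignedMeasure,
    VectorMeasure.integral_toSignedMeasure]
  · exact (le_abs_self _).trans (h f hf hfv)
  · rw [VectorMeasure.Integrable, Measure.variation_toSignedMeasure]
    exact hfd.integrable hV hη
  · rw [VectorMeasure.Integrable, Measure.variation_toSignedMeasure]
    exact hfd.integrable hV hη'

end ExpWeight

namespace FeynmanKac

variable {X : Type*} [MeasurableSpace X] {F : FeynmanKac X} {V : X → ℝ} {δ B : ℝ}

lemma gamma_zero (F : FeynmanKac X) (μ : Measure X) : F.gamma μ 0 = μ := by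
  simp [gamma, Q0]

lemma gamma_succ (F : FeynmanKac X) (μ : Measure X) (n : ℕ) :
    F.gamma μ (n + 1) = (F.gamma μ n).bind (F.Q n) := by
  simp only [gamma, Q0]
  exact Measure.comp_assoc.symm

lemma integral_eta (F : FeynmanKac X) (μ : Measure X) (n : ℕ) (f : X → ℝ) :
    ∫ x, f x ∂F.eta μ n = (∫ x, f x ∂F.gamma μ n) / (F.gamma μ n).real Set.univ := by
  rw [eta, integral_smul_measure, ENNReal.toReal_inv, smul_eq_mul, div_eq_inv_mul]
  rfl

/-- `F.propagate f k m` is the function `Q_{k+1} ⋯ Q_{k+m} f`. -/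
noncomputable def propagate (F : FeynmanKac X) (f : X → ℝ) : ℕ → ℕ → X → ℝ
  | _, 0 => f
  | k, m + 1 => fun x => ∫ y, F.propagate f (k + 1) m y ∂F.Q k x

lemma propagate_zero (F : FeynmanKac X) (f : X → ℝ) (k : ℕ) : F.propagate f k 0 = f := by
  rw [propagate]

lemma propagate_succ (F : FeynmanKac X) (f : X → ℝ) (k m : ℕ) (x : X) :
    F.propagate f k (m + 1) x = ∫ y, F.propagate f (k + 1) m y ∂F.Q k x := by
  rw [propagate]

lemma propagate_nonneg (F : FeynmanKac X) {f : X → ℝ} (hf : ∀ x, 0 ≤ f x) (k m : ℕ) (x : X) :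
    0 ≤ F.propagate f k m x := by
  induction m generalizing k x with
  | zero => exact F.propagate_zero f k ▸ hf x
  | succ m ih => exact F.propagate_succ f k m x ▸ integral_nonneg (ih (k + 1))

/-- The drift inequality `Q_n(e^V) ≤ e^{(1-δ)V + B}` on all of `X`: the multiplicative drift
condition at a single level, with `B` in place of `b_d 1_{C_d}`. -/
structure UniformDrift (F : FeynmanKac X) (V : X → ℝ) (δ B : ℝ) : Prop where
  measurable_V : Measurable V
  nonneg_V : ∀ x, 0 ≤ V x
  delta_pos : 0 < δ
  drift : ∀ n x, integralExp V (F.Q n x) ≤ ENNReal.ofReal (Real.exp (V x * (1 - δ) + B))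

namespace UniformDrift

lemma integralExp_Q_lt_top (h : F.UniformDrift V δ B) (n : ℕ) (x : X) :
    integralExp V (F.Q n x) < ∞ :=
  (h.drift n x).trans_lt ENNReal.ofReal_lt_top

lemma isFiniteMeasure_Q (h : F.UniformDrift V δ B) (n : ℕ) (x : X) : IsFiniteMeasure (F.Q n x) :=
  isFiniteMeasure_of_integralExp_lt_top h.nonneg_V (h.integralExp_Q_lt_top n x)

lemma integral_exp_Q_le (h : F.UniformDrift V δ B) (n : ℕ) (x : X) :
    ∫ y, Real.exp (V y) ∂F.Q n x ≤ Real.exp (V x * (1 - δ) + B) := by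
  rw [← ENNReal.ofReal_le_ofReal_iff (Real.exp_pos _).le,
    ofReal_integral_exp h.measurable_V (h.integralExp_Q_lt_top n x)]
  exact h.drift n x

lemma integral_exp_Q_le_mul (h : F.UniformDrift V δ B) (n : ℕ) (x : X) :
    ∫ y, Real.exp (V y) ∂F.Q n x ≤ Real.exp B * Real.exp (V x) := by
  refine (h.integral_exp_Q_le n x).trans ?_
  rw [← Real.exp_add, Real.exp_le_exp]
  nlinarith [mul_nonneg (h.nonneg_V x) h.delta_pos.le]

lemma integral_exp_Q_le_mul_of_notMem (h : F.UniformDrift V δ B) (n : ℕ) {x : X} {d : ℝ}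
    (hx : x ∉ sublevel V d) :
    ∫ y, Real.exp (V y) ∂F.Q n x ≤ Real.exp B * (Real.exp (-(δ * d)) * Real.exp (V x)) := by
  refine (h.integral_exp_Q_le n x).trans ?_
  rw [← Real.exp_add, ← Real.exp_add, Real.exp_le_exp]
  nlinarith [mul_le_mul_of_nonneg_left (not_le.1 hx).le h.delta_pos.le]

lemma expDominated_integral_Q (h : F.UniformDrift V δ B) {f : X → ℝ} (hf : ExpDominated V f)
    (n : ℕ) : ExpDominated V fun x => ∫ y, f y ∂F.Q n x := by
  have hint (x : X) := hf.integrable h.measurable_V (h.integralExp_Q_lt_top n x)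
  obtain ⟨hfm, K, hK⟩ := hf
  refine ⟨hfm.stronglyMeasurable.integral_kernel.measurable, |K| * Real.exp B, fun x => ?_⟩
  calc |∫ y, f y ∂F.Q n x| ≤ ∫ y, |f y| ∂F.Q n x := abs_integral_le_integral_abs
    _ ≤ ∫ y, |K| * Real.exp (V y) ∂F.Q n x := by
        refine integral_mono (hint x).abs
          ((integrable_exp h.measurable_V (h.integralExp_Q_lt_top n x)).const_mul _) fun y => ?_
        exact (hK y).trans (by gcongr; exact le_abs_self K)
    _ ≤ |K| * (Real.exp B * Real.exp (V x)) := by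
        rw [integral_const_mul]
        gcongr
        exact h.integral_exp_Q_le_mul n x
    _ = |K| * Real.exp B * Real.exp (V x) := by ring

lemma expDominated_propagate (h : F.UniformDrift V δ B) {f : X → ℝ} (hf : ExpDominated V f)
    (k m : ℕ) : ExpDominated V (F.propagate f k m) := by
  induction m generalizing k with
  | zero => rwa [propagate_zero]
  | succ m ih =>
    simpa only [← F.propagate_succ] using h.expDominated_integral_Q (ih (k + 1)) k

lemma integralExp_gamma_lt_top (h : F.UniformDrift V δ B) {μ : Measure X}
    (hμ : integralExp V μ < ∞) (n : ℕ) : integralExp V (F.gamma μ n) < ∞ := by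
  have hV := h.measurable_V
  induction n with
  | zero => rwa [gamma_zero]
  | succ n ih =>
    rw [gamma_succ, integralExp, Measure.lintegral_bind (F.Q n).aemeasurable (by fun_prop)]
    calc ∫⁻ x, integralExp V (F.Q n x) ∂F.gamma μ n
        ≤ ∫⁻ x, ENNReal.ofReal (Real.exp B) * ENNReal.ofReal (Real.exp (V x)) ∂F.gamma μ n := by
          gcongr with x
          rw [← ofReal_integral_exp hV (h.integralExp_Q_lt_top n x),
            ← ENNReal.ofReal_mul (Real.exp_pos _).le]
          exact ENNReal.ofReal_le_ofReal (h.integral_exp_Q_le_mul n x)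
      _ = ENNReal.ofReal (Real.exp B) * integralExp V (F.gamma μ n) :=
          lintegral_const_mul _ (by fun_prop)
      _ < ∞ := ENNReal.mul_lt_top ENNReal.ofReal_lt_top ih

lemma isFiniteMeasure_gamma (h : F.UniformDrift V δ B) {μ : Measure X}
    (hμ : integralExp V μ < ∞) (n : ℕ) : IsFiniteMeasure (F.gamma μ n) :=
  isFiniteMeasure_of_integralExp_lt_top h.nonneg_V (h.integralExp_gamma_lt_top hμ n)

lemma integralExp_eta_lt_top (h : F.UniformDrift V δ B) {μ : Measure X}
    (hμ : integralExp V μ < ∞) {n : ℕ} (hpos : 0 < (F.gamma μ n).real Set.univ) :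
    integralExp V (F.eta μ n) < ∞ := by
  rw [eta, integralExp, lintegral_smul_measure]
  exact ENNReal.mul_lt_top (ENNReal.inv_lt_top.2 (ENNReal.toReal_pos_iff.1 hpos).1)
    (h.integralExp_gamma_lt_top hμ n)

lemma integral_gamma_succ (h : F.UniformDrift V δ B) {μ : Measure X} (hμ : integralExp V μ < ∞)
    {f : X → ℝ} (hf : ExpDominated V f) (n : ℕ) :
    ∫ x, f x ∂F.gamma μ (n + 1) = ∫ x, ∫ y, f y ∂F.Q n x ∂F.gamma μ n := by
  have hint := hf.integrable h.measurable_V (h.integralExp_gamma_lt_top hμ (n + 1))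
  rw [gamma_succ, Measure.comp_eq_comp_const_apply] at hint ⊢
  rw [Kernel.integral_comp hint, Kernel.const_apply]

lemma integral_propagate_gamma (h : F.UniformDrift V δ B) {μ : Measure X}
    (hμ : integralExp V μ < ∞) {f : X → ℝ} (hf : ExpDominated V f) (k m : ℕ) :
    ∫ x, F.propagate f k m x ∂F.gamma μ k = ∫ x, f x ∂F.gamma μ (k + m) := by
  induction m generalizing k with
  | zero => rw [propagate_zero, add_zero]
  | succ m ih =>
    simp only [propagate_succ]
    rw [← h.integral_gamma_succ hμ (h.expDominated_propagate hf (k + 1) m) k, ih (k + 1),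
      add_right_comm, add_assoc]

lemma integral_propagate_zero (h : F.UniformDrift V δ B) {μ : Measure X}
    (hμ : integralExp V μ < ∞) {f : X → ℝ} (hf : ExpDominated V f) (n : ℕ) :
    ∫ x, F.propagate f 0 n x ∂μ = ∫ x, f x ∂F.gamma μ n := by
  simpa only [gamma_zero, zero_add] using h.integral_propagate_gamma hμ hf 0 n

end UniformDrift

/-- Two-sided comparison `e₁ ν ≤ Q_n(x, ·) ≤ e₂ ν` on the set `C`, uniformly in `n` and `x ∈ C`. -/
structure LocallyComparable (F : FeynmanKac X) (C : Set X) (e₁ e₂ : ℝ) (ν : Measure X) : Prop where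
  lower_pos : 0 < e₁
  upper_pos : 0 < e₂
  isFiniteMeasure : IsFiniteMeasure ν
  le_Q : ∀ n, ∀ x ∈ C, ENNReal.ofReal e₁ • ν.restrict C ≤ (F.Q n x).restrict C
  Q_le : ∀ n, ∀ x ∈ C, (F.Q n x).restrict C ≤ ENNReal.ofReal e₂ • ν.restrict C

/-- The antisymmetric function `D(x, y) = g(x) u(y) - u(x) g(y)`, where `g = Q_{k+1} ⋯ Q_{k+m} f`
and `u = Q_{k+1} ⋯ Q_{k+m} 1`. -/
noncomputable def pairDiff (F : FeynmanKac X) (f : X → ℝ) (k m : ℕ) (z : X × X) : ℝ :=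
  F.propagate f k m z.1 * F.propagate (fun _ => 1) k m z.2 -
    F.propagate (fun _ => 1) k m z.1 * F.propagate f k m z.2

lemma pairDiff_swap (F : FeynmanKac X) (f : X → ℝ) (k m : ℕ) (z : X × X) :
    F.pairDiff f k m z.swap = -F.pairDiff f k m z := by
  simp only [pairDiff, Prod.fst_swap, Prod.snd_swap]
  ring

/-- The function `a (u ⊗ u) + T (v ⊗ v)` with `u = Q_{k+1} ⋯ Q_{k+m} v` and `v = e^V`, in terms of
which `FeynmanKac.pairDiff` is bounded. -/
noncomputable def pairBound (F : FeynmanKac X) (V : X → ℝ) (k m : ℕ) (a T : ℝ) (z : X × X) : ℝ :=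
  a * (F.propagate (fun x => Real.exp (V x)) k m z.1 *
      F.propagate (fun x => Real.exp (V x)) k m z.2) +
    T * (Real.exp (V z.1) * Real.exp (V z.2))

lemma pairBound_mono_left (F : FeynmanKac X) (V : X → ℝ) (k m : ℕ) {a a' : ℝ} (ha : a ≤ a')
    (T : ℝ) (z : X × X) : F.pairBound V k m a T z ≤ F.pairBound V k m a' T z := by
  have hu := F.propagate_nonneg (fun x => (Real.exp_pos (V x)).le) k m
  exact add_le_add_left (mul_le_mul_of_nonneg_right ha (mul_nonneg (hu _) (hu _))) _

namespace UniformDrift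

section PairDiff

variable {f : X → ℝ} {η η' : Measure X}

lemma integrable_pairDiff (h : F.UniformDrift V δ B) (hf : ExpDominated V f) (k m : ℕ)
    (hη : integralExp V η < ∞) (hη' : integralExp V η' < ∞) :
    Integrable (F.pairDiff f k m) (η.prod η') := by
  have hV := h.measurable_V
  have hfd := h.expDominated_propagate hf k m
  have h1d := h.expDominated_propagate (.one h.nonneg_V) k m
  exact ((hfd.integrable hV hη).mul_prod (h1d.integrable hV hη')).sub
    ((h1d.integrable hV hη).mul_prod (hfd.integrable hV hη'))

lemma integral_pairDiff [SFinite η] [SFinite η'] (h : F.UniformDrift V δ B)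
    (hf : ExpDominated V f) (k m : ℕ) (hη : integralExp V η < ∞) (hη' : integralExp V η' < ∞) :
    ∫ z, F.pairDiff f k m z ∂η.prod η' =
      (∫ x, F.propagate f k m x ∂η) * (∫ y, F.propagate (fun _ => 1) k m y ∂η') -
      (∫ x, F.propagate (fun _ => 1) k m x ∂η) * (∫ y, F.propagate f k m y ∂η') := by
  have hV := h.measurable_V
  have hfd := h.expDominated_propagate hf k m
  have h1d := h.expDominated_propagate (.one h.nonneg_V) k m
  rw [← integral_prod_mul, ← integral_prod_mul]
  exact integral_sub ((hfd.integrable hV hη).mul_prod (h1d.integrable hV hη'))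
    ((h1d.integrable hV hη).mul_prod (hfd.integrable hV hη'))

lemma integrable_pairBound (h : F.UniformDrift V δ B) (k m : ℕ) (a T : ℝ)
    (hη : integralExp V η < ∞) (hη' : integralExp V η' < ∞) :
    Integrable (F.pairBound V k m a T) (η.prod η') := by
  have hV := h.measurable_V
  have hu := h.expDominated_propagate (.exp hV) k m
  exact (((hu.integrable hV hη).mul_prod (hu.integrable hV hη')).const_mul a).add
    (((integrable_exp hV hη).mul_prod (integrable_exp hV hη')).const_mul T)

lemma integral_pairBound [SFinite η] [SFinite η'] (h : F.UniformDrift V δ B) (k m : ℕ)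
    (a T : ℝ) (hη : integralExp V η < ∞) (hη' : integralExp V η' < ∞) :
    ∫ z, F.pairBound V k m a T z ∂η.prod η' =
      a * ((∫ x, F.propagate (fun x => Real.exp (V x)) k m x ∂η) *
        (∫ y, F.propagate (fun x => Real.exp (V x)) k m y ∂η')) +
      T * ((∫ x, Real.exp (V x) ∂η) * (∫ y, Real.exp (V y) ∂η')) := by
  have hV := h.measurable_V
  have hu := h.expDominated_propagate (.exp hV) k m
  rw [← integral_prod_mul, ← integral_prod_mul, ← integral_const_mul, ← integral_const_mul]
  exact integral_add (((hu.integrable hV hη).mul_prod (hu.integrable hV hη')).const_mul a)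
    (((integrable_exp hV hη).mul_prod (integrable_exp hV hη')).const_mul T)

end PairDiff

lemma pairDiff_succ (h : F.UniformDrift V δ B) {f : X → ℝ} (hf : ExpDominated V f) (k m : ℕ)
    (z : X × X) : F.pairDiff f k (m + 1) z =
      ∫ z', F.pairDiff f (k + 1) m z' ∂(F.Q k z.1).prod (F.Q k z.2) := by
  have := h.isFiniteMeasure_Q k
  rw [h.integral_pairDiff hf (k + 1) m (h.integralExp_Q_lt_top k z.1)
    (h.integralExp_Q_lt_top k z.2)]
  simp only [pairDiff, propagate_succ]

lemma integral_exp_mul_integral_exp_le (h : F.UniformDrift V δ B) (k : ℕ) (z : X × X) :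
    (∫ x, Real.exp (V x) ∂F.Q k z.1) * (∫ y, Real.exp (V y) ∂F.Q k z.2) ≤
      Real.exp (2 * B) * (Real.exp (V z.1) * Real.exp (V z.2)) := by
  calc (∫ x, Real.exp (V x) ∂F.Q k z.1) * (∫ y, Real.exp (V y) ∂F.Q k z.2)
      ≤ (Real.exp B * Real.exp (V z.1)) * (Real.exp B * Real.exp (V z.2)) :=
        mul_le_mul (h.integral_exp_Q_le_mul k z.1) (h.integral_exp_Q_le_mul k z.2)
          (integral_nonneg fun _ => (Real.exp_pos _).le) (by positivity)
    _ = Real.exp (2 * B) * (Real.exp (V z.1) * Real.exp (V z.2)) := by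
        rw [two_mul, Real.exp_add]
        ring

lemma integral_exp_mul_integral_exp_le_of_notMem (h : F.UniformDrift V δ B) (k : ℕ) {d : ℝ}
    {z : X × X} (hz : z ∉ sublevel V d ×ˢ sublevel V d) :
    (∫ x, Real.exp (V x) ∂F.Q k z.1) * (∫ y, Real.exp (V y) ∂F.Q k z.2) ≤
      Real.exp (2 * B) * Real.exp (-(δ * d)) * (Real.exp (V z.1) * Real.exp (V z.2)) := by
  have key {x y : X} (hx : x ∉ sublevel V d) :
      (∫ a, Real.exp (V a) ∂F.Q k x) * (∫ b, Real.exp (V b) ∂F.Q k y) ≤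
        Real.exp (2 * B) * Real.exp (-(δ * d)) * (Real.exp (V x) * Real.exp (V y)) :=
    calc (∫ a, Real.exp (V a) ∂F.Q k x) * (∫ b, Real.exp (V b) ∂F.Q k y)
        ≤ (Real.exp B * (Real.exp (-(δ * d)) * Real.exp (V x))) *
            (Real.exp B * Real.exp (V y)) :=
          mul_le_mul (h.integral_exp_Q_le_mul_of_notMem k hx) (h.integral_exp_Q_le_mul k y)
            (integral_nonneg fun _ => (Real.exp_pos _).le) (by positivity)
      _ = Real.exp (2 * B) * Real.exp (-(δ * d)) * (Real.exp (V x) * Real.exp (V y)) := by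
          rw [two_mul, Real.exp_add]
          ring
  rcases not_and_or.1 (Set.mem_prod.not.1 hz) with hx | hy
  · exact key hx
  · rw [mul_comm, mul_comm (Real.exp (V z.1))]
    exact key hy

lemma integral_pairBound_le (h : F.UniformDrift V δ B) (k m : ℕ) (a : ℝ) {T : ℝ} (hT : 0 ≤ T)
    (z : X × X) : ∫ z', F.pairBound V (k + 1) m a T z' ∂(F.Q k z.1).prod (F.Q k z.2) ≤
      F.pairBound V k (m + 1) a (T * Real.exp (2 * B)) z := by
  have := h.isFiniteMeasure_Q k
  rw [h.integral_pairBound (k + 1) m a T (h.integralExp_Q_lt_top k z.1)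
    (h.integralExp_Q_lt_top k z.2), pairBound, propagate_succ, propagate_succ, mul_assoc T]
  exact add_le_add_right
    (mul_le_mul_of_nonneg_left (h.integral_exp_mul_integral_exp_le k z) hT) _

lemma integral_pairBound_le_of_notMem (h : F.UniformDrift V δ B) (k m : ℕ) (a : ℝ) {T : ℝ}
    (hT : 0 ≤ T) {d : ℝ} {z : X × X} (hz : z ∉ sublevel V d ×ˢ sublevel V d) :
    ∫ z', F.pairBound V (k + 1) m a T z' ∂(F.Q k z.1).prod (F.Q k z.2) ≤
      F.pairBound V k (m + 1) a (T * (Real.exp (2 * B) * Real.exp (-(δ * d)))) z := by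
  have := h.isFiniteMeasure_Q k
  rw [h.integral_pairBound (k + 1) m a T (h.integralExp_Q_lt_top k z.1)
    (h.integralExp_Q_lt_top k z.2), pairBound, propagate_succ, propagate_succ, mul_assoc T]
  exact add_le_add_right
    (mul_le_mul_of_nonneg_left (h.integral_exp_mul_integral_exp_le_of_notMem k hz) hT) _

lemma abs_pairDiff_zero_le (h : F.UniformDrift V δ B) {f : X → ℝ}
    (hfv : ∀ x, |f x| ≤ Real.exp (V x)) (k : ℕ) {a T : ℝ} (haT : 2 ≤ a + T) (z : X × X) :
    |F.pairDiff f k 0 z| ≤ F.pairBound V k 0 a T z := by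
  have hv (x : X) : |(1 : ℝ)| ≤ Real.exp (V x) := by simpa using h.nonneg_V x
  simp only [pairDiff, pairBound, propagate_zero]
  calc |f z.1 * 1 - 1 * f z.2| ≤ |f z.1 * 1| + |1 * f z.2| := abs_sub _ _
    _ ≤ Real.exp (V z.1) * Real.exp (V z.2) + Real.exp (V z.1) * Real.exp (V z.2) := by
        rw [abs_mul, abs_mul]
        gcongr
        exacts [hfv _, hv _, hv _, hfv _]
    _ ≤ (a + T) * (Real.exp (V z.1) * Real.exp (V z.2)) := by
        rw [← two_mul]
        gcongr
    _ = _ := by ring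

lemma abs_pairDiff_succ_le_of_notMem (h : F.UniformDrift V δ B) {f : X → ℝ}
    (hf : ExpDominated V f) {k m : ℕ} {a T : ℝ} (hT : 0 ≤ T)
    (hD : ∀ z, |F.pairDiff f (k + 1) m z| ≤ F.pairBound V (k + 1) m a T z) {d : ℝ} {z : X × X}
    (hz : z ∉ sublevel V d ×ˢ sublevel V d) :
    |F.pairDiff f k (m + 1) z| ≤
      F.pairBound V k (m + 1) a (T * (Real.exp (2 * B) * Real.exp (-(δ * d)))) z := by
  have := h.isFiniteMeasure_Q k
  have hz₁ := h.integralExp_Q_lt_top k z.1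
  have hz₂ := h.integralExp_Q_lt_top k z.2
  rw [h.pairDiff_succ hf]
  exact abs_integral_le_integral_abs.trans
    ((integral_mono (h.integrable_pairDiff hf (k + 1) m hz₁ hz₂).abs
      (h.integrable_pairBound (k + 1) m a T hz₁ hz₂) hD).trans
      (h.integral_pairBound_le_of_notMem k m a hT hz))

lemma abs_pairDiff_succ_le_of_mem (h : F.UniformDrift V δ B) {d e₁ e₂ : ℝ} {ν : Measure X}
    (hC : F.LocallyComparable (sublevel V d) e₁ e₂ ν) {w : ℝ} (hw : 1 - (e₁ / e₂) ^ 2 ≤ w)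
    (hw0 : 0 ≤ w) (hw1 : w ≤ 1) {f : X → ℝ} (hf : ExpDominated V f) {k m : ℕ} {a T : ℝ}
    (hT : 0 ≤ T) (hD : ∀ z, |F.pairDiff f (k + 1) m z| ≤ F.pairBound V (k + 1) m a T z)
    (hDout : ∀ z ∉ sublevel V d ×ˢ sublevel V d,
      |F.pairDiff f (k + 1) m z| ≤ F.pairBound V (k + 1) m (w * a) T z)
    {z : X × X} (hz : z ∈ sublevel V d ×ˢ sublevel V d) :
    |F.pairDiff f k (m + 1) z| ≤
      F.pairBound V k (m + 1) (w * a) (T * Real.exp (2 * B)) z := by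
  have := h.isFiniteMeasure_Q k
  have := hC.isFiniteMeasure
  have hz₁ := h.integralExp_Q_lt_top k z.1
  have hz₂ := h.integralExp_Q_lt_top k z.2
  have hDin (z : X × X) :
      w * |F.pairDiff f (k + 1) m z| ≤ F.pairBound V (k + 1) m (w * a) T z := by
    refine (mul_le_mul_of_nonneg_left (hD z) hw0).trans ?_
    rw [pairBound, pairBound, mul_add, ← mul_assoc]
    exact add_le_add_right (mul_le_of_le_one_left (by positivity) hw1) _
  rw [h.pairDiff_succ hf]
  exact (abs_integral_prod_le_of_antisymm_of_restrict (measurableSet_sublevel h.measurable_V d)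
    hC.lower_pos hC.upper_pos hw (hC.le_Q k _ hz.1) (hC.Q_le k _ hz.1) (hC.le_Q k _ hz.2)
    (hC.Q_le k _ hz.2)
    (h.integrable_pairDiff hf (k + 1) m hz₁ hz₂) (F.pairDiff_swap f (k + 1) m)
    (h.integrable_pairBound (k + 1) m (w * a) T hz₁ hz₂) (fun z _ => hDin z) hDout).trans
    (h.integral_pairBound_le k m (w * a) hT z)

-- Each of the `J` pairs outside `C_d × C_d` spoils the transitions into and out of it, and the
-- final pair may spoil one more; a trajectory that starts outside has no transition into its first
-- pair.
theorem abs_pairDiff_le (h : F.UniformDrift V δ B) {d e₁ e₂ : ℝ} {ν : Measure X} (hd : 0 ≤ d)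
    (hC : F.LocallyComparable (sublevel V d) e₁ e₂ ν) {w : ℝ} (hw : 1 - (e₁ / e₂) ^ 2 ≤ w)
    (hw0 : 0 < w) (hw1 : w ≤ 1) {f : X → ℝ} (hf : Measurable f)
    (hfv : ∀ x, |f x| ≤ Real.exp (V x)) (k m : ℕ) (J : ℝ) :
    (∀ z, |F.pairDiff f k m z| ≤ F.pairBound V k m (2 * w ^ (m - 1 - 2 * J))
      (2 * Real.exp (-(δ * d)) ^ J * Real.exp (2 * B) ^ m) z) ∧
    ∀ z ∉ sublevel V d ×ˢ sublevel V d, |F.pairDiff f k m z| ≤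
      F.pairBound V k m (2 * w ^ (m - 2 * J))
        (2 * Real.exp (-(δ * d)) ^ J * Real.exp (2 * B) ^ m) z := by
  have hfd := ExpDominated.of_abs_le_exp hf hfv
  have hθ := Real.exp_pos (-(δ * d))
  have hθ1 : Real.exp (-(δ * d)) ≤ 1 := Real.exp_le_one_iff.2 (by nlinarith [h.delta_pos])
  induction m generalizing k J with
  | zero =>
    have hbase {s : ℝ} (hs : s ≤ -(2 * J)) :
        2 ≤ 2 * w ^ s + 2 * Real.exp (-(δ * d)) ^ J * Real.exp (2 * B) ^ 0 := by
      have hws := Real.rpow_pos_of_pos hw0 s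
      have hθJ := Real.rpow_pos_of_pos hθ J
      rcases le_total 0 J with hJ | hJ
      · linarith [Real.one_le_rpow_of_pos_of_le_one_of_nonpos hw0 hw1 (show s ≤ 0 by linarith)]
      · linarith [Real.one_le_rpow_of_pos_of_le_one_of_nonpos hθ hθ1 hJ]
    exact ⟨h.abs_pairDiff_zero_le hfv k (hbase (by norm_num)),
      fun z _ => h.abs_pairDiff_zero_le hfv k (hbase (by norm_num)) z⟩
  | succ m ih =>
    have hout : ∀ z ∉ sublevel V d ×ˢ sublevel V d, |F.pairDiff f k (m + 1) z| ≤
        F.pairBound V k (m + 1) (2 * w ^ ((m + 1 : ℕ) - 2 * J))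
          (2 * Real.exp (-(δ * d)) ^ J * Real.exp (2 * B) ^ (m + 1)) z := by
      intro z hz
      convert h.abs_pairDiff_succ_le_of_notMem hfd (by positivity) (ih (k + 1) (J - 1)).1 hz
        using 2
      · push_cast
        ring_nf
      · rw [Real.rpow_sub_one hθ.ne', pow_succ]
        field_simp
    refine ⟨fun z => ?_, hout⟩
    by_cases hz : z ∈ sublevel V d ×ˢ sublevel V d
    · have hgain : w * (2 * w ^ (m - 1 - 2 * J)) = 2 * w ^ (m - 2 * J) := by
        rw [mul_left_comm, mul_comm w, ← Real.rpow_add_one hw0.ne']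
        ring_nf
      convert h.abs_pairDiff_succ_le_of_mem hC hw hw0.le hw1 hfd (by positivity)
        (ih (k + 1) J).1 (hgain ▸ (ih (k + 1) J).2) hz using 2
      · rw [hgain]
        push_cast
        ring_nf
      · ring
    · refine (hout z hz).trans (F.pairBound_mono_left V k (m + 1) ?_ _ z)
      gcongr 2 * ?_
      exact Real.rpow_le_rpow_of_exponent_ge hw0 hw1 (by linarith)

section Eta

variable {d e₁ e₂ w : ℝ} {ν μ μ' : Measure X} {f : X → ℝ}

lemma abs_integral_gamma_mul_sub_le (h : F.UniformDrift V δ B) (hd : 0 ≤ d)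
    (hC : F.LocallyComparable (sublevel V d) e₁ e₂ ν) (hw : 1 - (e₁ / e₂) ^ 2 ≤ w) (hw0 : 0 < w)
    (hw1 : w ≤ 1) (hμ : integralExp V μ < ∞) (hμ' : integralExp V μ' < ∞) (hf : Measurable f)
    (hfv : ∀ x, |f x| ≤ Real.exp (V x)) (n : ℕ) (J : ℝ) :
    |(∫ x, f x ∂F.gamma μ n) * (F.gamma μ' n).real Set.univ -
        (F.gamma μ n).real Set.univ * ∫ x, f x ∂F.gamma μ' n| ≤
      2 * w ^ (n - 1 - 2 * J) *
          ((∫ x, Real.exp (V x) ∂F.gamma μ n) * ∫ x, Real.exp (V x) ∂F.gamma μ' n) +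
        2 * Real.exp (-(δ * d)) ^ J * Real.exp (2 * B) ^ n *
          ((∫ x, Real.exp (V x) ∂μ) * ∫ x, Real.exp (V x) ∂μ') := by
  have := isFiniteMeasure_of_integralExp_lt_top h.nonneg_V hμ
  have := isFiniteMeasure_of_integralExp_lt_top h.nonneg_V hμ'
  have hfd := ExpDominated.of_abs_le_exp hf hfv
  have hvd := ExpDominated.exp h.measurable_V
  have hmass {η : Measure X} (hη : integralExp V η < ∞) :
      ∫ x, F.propagate (fun _ => 1) 0 n x ∂η = (F.gamma η n).real Set.univ := by
    rw [h.integral_propagate_zero hη (.one h.nonneg_V), integral_const, smul_eq_mul, mul_one]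
  have hD := h.integral_pairDiff hfd 0 n hμ hμ'
  rw [hmass hμ, hmass hμ', h.integral_propagate_zero hμ hfd,
    h.integral_propagate_zero hμ' hfd] at hD
  rw [← hD, ← h.integral_propagate_zero hμ hvd, ← h.integral_propagate_zero hμ' hvd,
    ← h.integral_pairBound 0 n _ _ hμ hμ']
  exact abs_integral_le_integral_abs.trans
    (integral_mono (h.integrable_pairDiff hfd 0 n hμ hμ').abs
      (h.integrable_pairBound 0 n _ _ hμ hμ')
      (h.abs_pairDiff_le hd hC hw hw0 hw1 hf hfv 0 n J).1)

lemma abs_integral_eta_sub_le (h : F.UniformDrift V δ B) (hd : 0 ≤ d)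
    (hC : F.LocallyComparable (sublevel V d) e₁ e₂ ν) (hw : 1 - (e₁ / e₂) ^ 2 ≤ w) (hw0 : 0 < w)
    (hw1 : w ≤ 1) (hμ : integralExp V μ < ∞) (hμ' : integralExp V μ' < ∞) (hf : Measurable f)
    (hfv : ∀ x, |f x| ≤ Real.exp (V x)) {n : ℕ} {K K' p p' : ℝ} (hp : 0 < p) (hp' : 0 < p')
    (hK : ∫ x, Real.exp (V x) ∂F.gamma μ n ≤ K * (F.gamma μ n).real Set.univ)
    (hK' : ∫ x, Real.exp (V x) ∂F.gamma μ' n ≤ K' * (F.gamma μ' n).real Set.univ)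
    (hpS : p ≤ (F.gamma μ n).real Set.univ) (hpS' : p' ≤ (F.gamma μ' n).real Set.univ) (J : ℝ) :
    |∫ x, f x ∂F.eta μ n - ∫ x, f x ∂F.eta μ' n| ≤
      2 * w ^ (n - 1 - 2 * J) * (K * K') +
        2 * Real.exp (-(δ * d)) ^ J * Real.exp (2 * B) ^ n *
          ((∫ x, Real.exp (V x) ∂μ) * ∫ x, Real.exp (V x) ∂μ') / (p * p') := by
  have hexp (η : Measure X) : 0 ≤ ∫ x, Real.exp (V x) ∂η :=
    integral_nonneg fun _ => (Real.exp_pos _).le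
  have hA := mul_nonneg (hexp μ) (hexp μ')
  have hS := mul_pos (hp.trans_le hpS) (hp'.trans_le hpS')
  have hSS := mul_le_mul hpS hpS' hp'.le (hp.trans_le hpS).le
  rw [integral_eta, integral_eta,
    div_sub_div _ _ (hp.trans_le hpS).ne' (hp'.trans_le hpS').ne', abs_div, abs_of_pos hS,
    div_le_iff₀ hS, add_mul]
  refine (h.abs_integral_gamma_mul_sub_le hd hC hw hw0 hw1 hμ hμ' hf hfv n J).trans
    (add_le_add ?_ ?_)
  · rw [mul_assoc _ (K * K'), mul_mul_mul_comm K]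
    exact mul_le_mul_of_nonneg_left
      (mul_le_mul hK hK' (hexp _) ((hexp _).trans hK)) (by positivity)
  · rw [div_mul_eq_mul_div, le_div_iff₀ (mul_pos hp hp')]
    exact mul_le_mul_of_nonneg_left hSS (mul_nonneg (by positivity) hA)

end Eta

lemma integral_exp_gamma_succ_le (h : F.UniformDrift V δ B) {μ : Measure X}
    (hμ : integralExp V μ < ∞) (d : ℝ) (n : ℕ) :
    ∫ x, Real.exp (V x) ∂F.gamma μ (n + 1) ≤
      Real.exp B * Real.exp (-(δ * d)) * ∫ x, Real.exp (V x) ∂F.gamma μ n +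
        Real.exp (B + d) * (F.gamma μ n).real (sublevel V d) := by
  have hγ := h.integralExp_gamma_lt_top hμ n
  have := h.isFiniteMeasure_gamma hμ n
  have hV := h.measurable_V
  have hd := measurableSet_sublevel hV d
  have hindicator : Integrable ((sublevel V d).indicator fun _ => Real.exp (B + d))
      (F.gamma μ n) := (integrable_const _).indicator hd
  have hpointwise (x : X) : ∫ y, Real.exp (V y) ∂F.Q n x ≤
      Real.exp B * Real.exp (-(δ * d)) * Real.exp (V x) +
        (sublevel V d).indicator (fun _ => Real.exp (B + d)) x := by
    by_cases hx : x ∈ sublevel V d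
    · rw [Set.indicator_of_mem hx, Real.exp_add B d]
      refine (h.integral_exp_Q_le_mul n x).trans (le_add_of_nonneg_of_le (by positivity) ?_)
      gcongr
      exact hx
    · rw [Set.indicator_of_notMem hx, add_zero, mul_assoc]
      exact h.integral_exp_Q_le_mul_of_notMem n hx
  rw [h.integral_gamma_succ hμ (.exp hV) n]
  calc ∫ x, ∫ y, Real.exp (V y) ∂F.Q n x ∂F.gamma μ n
      ≤ ∫ x, (Real.exp B * Real.exp (-(δ * d)) * Real.exp (V x) +
          (sublevel V d).indicator (fun _ => Real.exp (B + d)) x) ∂F.gamma μ n :=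
        integral_mono ((h.expDominated_integral_Q (.exp hV) n).integrable hV hγ)
          (((integrable_exp hV hγ).const_mul _).add hindicator) hpointwise
    _ = Real.exp B * Real.exp (-(δ * d)) * ∫ x, Real.exp (V x) ∂F.gamma μ n +
          Real.exp (B + d) * (F.gamma μ n).real (sublevel V d) := by
        rw [integral_add ((integrable_exp hV hγ).const_mul _) hindicator, integral_const_mul,
          integral_indicator hd, setIntegral_const, smul_eq_mul, mul_comm (Real.exp (B + d))]

end UniformDrift

/-- Two-sided comparison of all `Q_n` with `ν_d` on each `C_d = sublevel V d`, `d ≥ dlow`, where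
every `ν_d` charges the smallest of these sets. -/
structure LocalComparison (F : FeynmanKac X) (V : X → ℝ) (dlow : ℝ) (εm εp : ℝ → ℝ)
    (ν : ℝ → Measure X) : Prop where
  comparable : ∀ d, dlow ≤ d → F.LocallyComparable (sublevel V d) (εm d) (εp d) (ν d)
  nu_pos : ∀ d, dlow ≤ d → 0 < ν d (sublevel V dlow)

/-- The number `ε_d⁻ ν_d(C_dlow)`, a lower bound for `Q_n(x, C_dlow)` over all `x ∈ C_d`. -/
noncomputable def returnRate (V : X → ℝ) (dlow : ℝ) (εm : ℝ → ℝ) (ν : ℝ → Measure X) (d : ℝ) : ℝ :=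
  εm d * (ν d).real (sublevel V dlow)

/-- Bounds along the unnormalised flow `γ_n` started from `μ`: the `v`-moment of `γ_n` is at most
`K` times its mass, and the mass is at least `c l ^ n`. -/
structure MassControl (F : FeynmanKac X) (V : X → ℝ) (μ : Measure X) (l K c : ℝ) : Prop where
  integral_exp_le : ∀ n, ∫ x, Real.exp (V x) ∂F.gamma μ n ≤ K * (F.gamma μ n).real Set.univ
  mul_pow_le : ∀ n, c * l ^ n ≤ (F.gamma μ n).real Set.univ

lemma LocallyComparable.mul_gamma_le {C S : Set X} {e₁ e₂ : ℝ} {ν μ : Measure X}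
    (hC : F.LocallyComparable C e₁ e₂ ν) (hS : MeasurableSet S) (hSC : S ⊆ C) (n : ℕ)
    [IsFiniteMeasure (F.gamma μ (n + 1))] :
    e₁ * ν.real S * (F.gamma μ n).real C ≤ (F.gamma μ (n + 1)).real S := by
  have hmin (x : X) (hx : x ∈ C) : ENNReal.ofReal e₁ * ν S ≤ F.Q n x S := by
    simpa only [Measure.smul_apply, smul_eq_mul, Measure.restrict_apply hS,
      Set.inter_eq_left.2 hSC] using hC.le_Q n x hx S
  have hmass : ENNReal.ofReal e₁ * ν S * F.gamma μ n C ≤ F.gamma μ (n + 1) S := by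
    rw [gamma_succ, Measure.bind_apply hS (F.Q n).aemeasurable, ← setLIntegral_const]
    exact (setLIntegral_mono ((F.Q n).measurable_coe hS) hmin).trans (setLIntegral_le_lintegral _ _)
  have := ENNReal.toReal_mono (measure_ne_top _ _) hmass
  rwa [ENNReal.toReal_mul, ENNReal.toReal_mul, ENNReal.toReal_ofReal hC.lower_pos.le] at this

namespace LocalComparison

variable {dlow : ℝ} {εm εp : ℝ → ℝ} {ν : ℝ → Measure X} {μ : Measure X}

lemma returnRate_pos (hF : F.LocalComparison V dlow εm εp ν) {d : ℝ} (hd : dlow ≤ d) :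
    0 < returnRate V dlow εm ν d := by
  have := (hF.comparable d hd).isFiniteMeasure
  exact mul_pos (hF.comparable d hd).lower_pos
    (ENNReal.toReal_pos (hF.nu_pos d hd).ne' (measure_ne_top _ _))

lemma returnRate_mul_gamma_le (hF : F.LocalComparison V dlow εm εp ν)
    (h : F.UniformDrift V δ B) (hμ : integralExp V μ < ∞) {d : ℝ} (hd : dlow ≤ d) (n : ℕ) :
    returnRate V dlow εm ν d * (F.gamma μ n).real (sublevel V d) ≤
      (F.gamma μ (n + 1)).real (sublevel V dlow) := by
  have := h.isFiniteMeasure_gamma hμ (n + 1)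
  exact (hF.comparable d hd).mul_gamma_le (measurableSet_sublevel h.measurable_V dlow)
    (fun _ hx => hx.trans hd) n

lemma returnRate_pow_le_gamma (hF : F.LocalComparison V dlow εm εp ν)
    (h : F.UniformDrift V δ B) (hμ : integralExp V μ < ∞) {r : ℝ} (hr : dlow ≤ r) (n : ℕ) :
    returnRate V dlow εm ν dlow ^ n * (returnRate V dlow εm ν r * μ.real (sublevel V r)) ≤
      (F.gamma μ (n + 1)).real (sublevel V dlow) := by
  have hstart := hF.returnRate_mul_gamma_le h hμ hr 0
  rw [gamma_zero] at hstart
  refine le_trans ?_ (geom_le (hF.returnRate_pos le_rfl).le n fun k _ =>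
    hF.returnRate_mul_gamma_le h hμ le_rfl (k + 1))
  exact mul_le_mul_of_nonneg_left hstart (pow_nonneg (hF.returnRate_pos le_rfl).le n)

end LocalComparison

lemma le_mul_of_drift_of_minorization {L g k : ℕ → ℝ} {l c K C : ℝ} (hl : 0 ≤ l) (hC : 0 ≤ C)
    (hk : ∀ n, 0 ≤ k n) (hL : ∀ n, L (n + 1) ≤ l / 2 * L n + K * k n)
    (hlg : ∀ n, l * g n ≤ g (n + 1)) (hck : ∀ n, c * k n ≤ g (n + 1)) (hKC : 2 * K ≤ C * c)
    (h0 : L 0 ≤ C * g 0) (n : ℕ) : L n ≤ C * g n := by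
  induction n with
  | zero => exact h0
  | succ n ih =>
    calc L (n + 1) ≤ l / 2 * (C * g n) + C * c / 2 * k n := by
          refine (hL n).trans (add_le_add (mul_le_mul_of_nonneg_left ih (by positivity)) ?_)
          exact mul_le_mul_of_nonneg_right (by linarith) (hk n)
      _ = C / 2 * (l * g n) + C / 2 * (c * k n) := by ring
      _ ≤ C / 2 * g (n + 1) + C / 2 * g (n + 1) := by
          gcongr
          exacts [hlg n, hck n]
      _ = C * g (n + 1) := by ring

lemma eventually_exp_neg_mul_le (hδ : 0 < δ) {a : ℝ} (ha : 0 < a) :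
    ∀ᶠ d in Filter.atTop, Real.exp (-(δ * d)) ≤ a :=
  (Real.tendsto_exp_neg_atTop_nhds_zero.comp
    (Filter.tendsto_id.const_mul_atTop hδ)).eventually_le_const ha

section MassControl

variable {dlow : ℝ} {εm εp : ℝ → ℝ} {ν : ℝ → Measure X} {μ : Measure X}

lemma LocalComparison.integral_exp_gamma_succ_le_mul (hF : F.LocalComparison V dlow εm εp ν)
    (h : F.UniformDrift V δ B) (hμ : integralExp V μ < ∞) {d r K : ℝ} (hd : dlow ≤ d)
    (hdl : Real.exp B * Real.exp (-(δ * d)) ≤ returnRate V dlow εm ν dlow / 2) (hr : dlow ≤ r)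
    (hK : 0 ≤ K) (hKd : 2 * Real.exp (B + d) ≤ K * returnRate V dlow εm ν d)
    (hKr : Real.exp B * Real.exp (-(δ * d)) * ∫ x, Real.exp (V x) ∂μ +
      Real.exp (B + d) * μ.real (sublevel V d) ≤
        K * (returnRate V dlow εm ν r * μ.real (sublevel V r))) (n : ℕ) :
    ∫ x, Real.exp (V x) ∂F.gamma μ (n + 1) ≤
      K * (F.gamma μ (n + 1)).real (sublevel V dlow) := by
  refine le_mul_of_drift_of_minorization
    (L := fun n => ∫ x, Real.exp (V x) ∂F.gamma μ (n + 1))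
    (k := fun n => (F.gamma μ (n + 1)).real (sublevel V d)) (K := Real.exp (B + d))
    (hF.returnRate_pos le_rfl).le hK (fun _ => measureReal_nonneg) (fun n => ?_)
    (fun n => hF.returnRate_mul_gamma_le h hμ le_rfl (n + 1))
    (fun n => hF.returnRate_mul_gamma_le h hμ hd (n + 1)) hKd ?_ n
  · refine (h.integral_exp_gamma_succ_le hμ d (n + 1)).trans (add_le_add_left ?_ _)
    exact mul_le_mul_of_nonneg_right hdl (integral_nonneg fun _ => (Real.exp_pos _).le)
  · have hdrift := h.integral_exp_gamma_succ_le hμ d 0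
    have hmass := hF.returnRate_pow_le_gamma h hμ hr 0
    rw [gamma_zero] at hdrift
    rw [pow_zero, one_mul] at hmass
    exact hdrift.trans (hKr.trans (mul_le_mul_of_nonneg_left hmass hK))

lemma exists_massControl (hδ : 0 < δ) (B : ℝ) (εp : ℝ → ℝ)
    (hrate : ∀ d, dlow ≤ d → 0 < returnRate V dlow εm ν d) (hμ : MemP V μ) :
    ∃ K c : ℝ, 0 ≤ K ∧ 0 < c ∧ ∀ F : FeynmanKac X, F.UniformDrift V δ B →
      F.LocalComparison V dlow εm εp ν →
        F.MassControl V μ (returnRate V dlow εm ν dlow) K c := by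
  have := hμ.1
  set l := returnRate V dlow εm ν dlow
  have hl : 0 < l := hrate dlow le_rfl
  obtain ⟨r, hr, hμr⟩ := exists_measure_sublevel_pos V μ dlow
  set m := returnRate V dlow εm ν r * μ.real (sublevel V r)
  have hm : 0 < m := mul_pos (hrate r hr) (ENNReal.toReal_pos hμr.ne' (measure_ne_top _ _))
  obtain ⟨d, hd, hdl⟩ := ((Filter.eventually_ge_atTop dlow).and (eventually_exp_neg_mul_le hδ
    (show 0 < l / 2 / Real.exp B by positivity))).exists
  rw [le_div_iff₀' (Real.exp_pos B)] at hdl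
  set A := ∫ x, Real.exp (V x) ∂μ
  set A₁ := Real.exp B * Real.exp (-(δ * d)) * A + Real.exp (B + d) * μ.real (sublevel V d)
  set K := max A (max (A₁ / m) (2 * Real.exp (B + d) / returnRate V dlow εm ν d))
  have hKA : A ≤ K := le_max_left _ _
  have hKm : A₁ ≤ K * m := (div_le_iff₀ hm).1 ((le_max_left _ _).trans (le_max_right _ _))
  have hKd : 2 * Real.exp (B + d) ≤ K * returnRate V dlow εm ν d :=
    (div_le_iff₀ (hrate d hd)).1 ((le_max_right _ _).trans (le_max_right _ _))
  have hK : 0 ≤ K := (integral_nonneg fun _ => (Real.exp_pos _).le).trans hKA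
  refine ⟨K, min 1 (m / l), hK, by positivity, fun F h hF => ⟨fun n => ?_, fun n => ?_⟩⟩
  all_goals
    have := h.isFiniteMeasure_gamma hμ.2 n
    rcases n with _ | n
  · rw [gamma_zero, probReal_univ, mul_one]
    exact hKA
  · exact (hF.integral_exp_gamma_succ_le_mul h hμ.2 hd hdl hr hK hKd hKm n).trans
      (mul_le_mul_of_nonneg_left (measureReal_mono (Set.subset_univ _)) hK)
  · rw [gamma_zero, probReal_univ, pow_zero, mul_one]
    exact min_le_left _ _
  · calc min 1 (m / l) * l ^ (n + 1) ≤ m / l * l ^ (n + 1) := by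
          gcongr
          exact min_le_right _ _
      _ = l ^ n * m := by
          rw [pow_succ]
          field_simp
      _ ≤ (F.gamma μ (n + 1)).real Set.univ :=
          (hF.returnRate_pow_le_gamma h hμ.2 hr n).trans (measureReal_mono (Set.subset_univ _))

end MassControl

lemma rpow_div_four_mul_pow_le {θ E l : ℝ} (hθ : 0 ≤ θ) (hE : 0 < E)
    (hθE : θ ≤ (l ^ 2 / (2 * E)) ^ 4) (n : ℕ) :
    θ ^ ((n : ℝ) / 4) * E ^ n ≤ (1 / 2) ^ n * (l ^ n * l ^ n) := by
  have hrpow : θ ^ ((n : ℝ) / 4) ≤ (l ^ 2 / (2 * E)) ^ n :=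
    calc θ ^ ((n : ℝ) / 4) ≤ ((l ^ 2 / (2 * E)) ^ 4) ^ ((n : ℝ) / 4) := by gcongr
      _ = (l ^ 2 / (2 * E)) ^ n := by
        rw [← Real.rpow_natCast _ 4, ← Real.rpow_mul (by positivity), ← Real.rpow_natCast _ n]
        congr 1
        push_cast
        ring
  calc θ ^ ((n : ℝ) / 4) * E ^ n ≤ (l ^ 2 / (2 * E)) ^ n * E ^ n := by gcongr
    _ = (1 / 2) ^ n * (l ^ n * l ^ n) := by
      rw [← mul_pow, ← mul_pow, ← mul_pow]
      congr 1
      field_simp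

lemma rpow_sub_one_sub_two_mul_div_four {w : ℝ} (hw : 0 < w) (n : ℕ) :
    w ^ ((n : ℝ) - 1 - 2 * ((n : ℝ) / 4)) = √w ^ n * w⁻¹ := by
  rw [Real.sqrt_eq_rpow, ← Real.rpow_mul_natCast hw.le, ← div_eq_mul_inv,
    ← Real.rpow_sub_one hw.ne']
  congr 1
  ring

lemma exists_contraction_factor {e₁ e₂ : ℝ} (he₁ : 0 < e₁) (he₂ : 0 < e₂) :
    ∃ w, 0 < w ∧ w < 1 ∧ 1 - (e₁ / e₂) ^ 2 ≤ w :=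
  ⟨max (1 / 2) (1 - (e₁ / e₂) ^ 2), lt_max_of_lt_left (by norm_num),
    max_lt (by norm_num) (sub_lt_self 1 (by positivity)), le_max_right _ _⟩

lemma one_le_integral_exp (hV : Measurable V) (hV0 : ∀ x, 0 ≤ V x) {μ : Measure X}
    (hμ : MemP V μ) : 1 ≤ ∫ x, Real.exp (V x) ∂μ := by
  have := hμ.1
  rw [← ENNReal.one_le_ofReal, ofReal_integral_exp hV hμ.2, ← measure_univ (μ := μ)]
  exact measure_univ_le_integralExp hV0

namespace UniformDrift

variable {d e₁ e₂ w l K K' c c' : ℝ} {ν μ μ' : Measure X}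

lemma abs_integral_eta_sub_le_pow (h : F.UniformDrift V δ B) (hd : 0 ≤ d)
    (hC : F.LocallyComparable (sublevel V d) e₁ e₂ ν) (hw : 1 - (e₁ / e₂) ^ 2 ≤ w) (hw0 : 0 < w)
    (hw1 : w ≤ 1) (hl : 0 < l) (hdl : Real.exp (-(δ * d)) ≤ (l ^ 2 / (2 * Real.exp (2 * B))) ^ 4)
    (hμ : MemP V μ) (hμ' : MemP V μ') (hK : 0 ≤ K) (hK' : 0 ≤ K') (hc : 0 < c) (hc' : 0 < c')
    (hm : F.MassControl V μ l K c) (hm' : F.MassControl V μ' l K' c') {f : X → ℝ}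
    (hf : Measurable f) (hfv : ∀ x, |f x| ≤ Real.exp (V x)) (n : ℕ) :
    |∫ x, f x ∂F.eta μ n - ∫ x, f x ∂F.eta μ' n| ≤
      max √w (1 / 2) ^ n * (2 * (w⁻¹ * (K * K')) + 2 / (c * c')) *
        ((∫ x, Real.exp (V x) ∂μ) * ∫ x, Real.exp (V x) ∂μ') := by
  set A := ∫ x, Real.exp (V x) ∂μ
  set A' := ∫ x, Real.exp (V x) ∂μ'
  set ρ := max √w (1 / 2)
  have hA : 1 ≤ A * A' := one_le_mul_of_one_le_of_one_le
    (one_le_integral_exp h.measurable_V h.nonneg_V hμ)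
    (one_le_integral_exp h.measurable_V h.nonneg_V hμ')
  have hgood : 2 * w ^ ((n : ℝ) - 1 - 2 * ((n : ℝ) / 4)) * (K * K') ≤
      ρ ^ n * (2 * (w⁻¹ * (K * K'))) * (A * A') :=
    calc 2 * w ^ ((n : ℝ) - 1 - 2 * ((n : ℝ) / 4)) * (K * K')
        = √w ^ n * (2 * (w⁻¹ * (K * K'))) := by
          rw [rpow_sub_one_sub_two_mul_div_four hw0]
          ring
      _ ≤ ρ ^ n * (2 * (w⁻¹ * (K * K'))) := by
          gcongr
          exact le_max_left _ _
      _ ≤ ρ ^ n * (2 * (w⁻¹ * (K * K'))) * (A * A') :=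
          le_mul_of_one_le_right (by positivity) hA
  have hbad : 2 * Real.exp (-(δ * d)) ^ ((n : ℝ) / 4) * Real.exp (2 * B) ^ n * (A * A') /
      (c * l ^ n * (c' * l ^ n)) ≤ ρ ^ n * (2 / (c * c')) * (A * A') :=
    calc 2 * Real.exp (-(δ * d)) ^ ((n : ℝ) / 4) * Real.exp (2 * B) ^ n * (A * A') /
          (c * l ^ n * (c' * l ^ n))
        = 2 * (A * A') / (c * l ^ n * (c' * l ^ n)) *
            (Real.exp (-(δ * d)) ^ ((n : ℝ) / 4) * Real.exp (2 * B) ^ n) := by ring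
      _ ≤ 2 * (A * A') / (c * l ^ n * (c' * l ^ n)) * ((1 / 2) ^ n * (l ^ n * l ^ n)) :=
          mul_le_mul_of_nonneg_left
            (rpow_div_four_mul_pow_le (Real.exp_pos _).le (Real.exp_pos _) hdl n) (by positivity)
      _ = (1 / 2) ^ n * (2 / (c * c')) * (A * A') := by field_simp
      _ ≤ ρ ^ n * (2 / (c * c')) * (A * A') := by
          gcongr
          exact le_max_right _ _
  refine (h.abs_integral_eta_sub_le hd hC hw hw0 hw1 hμ.2 hμ'.2 hf hfv
    (mul_pos hc (pow_pos hl n)) (mul_pos hc' (pow_pos hl n)) (hm.integral_exp_le n)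
    (hm'.integral_exp_le n) (hm.mul_pow_le n) (hm'.mul_pow_le n) (n / 4)).trans ?_
  rw [mul_add, add_mul]
  exact add_le_add hgood hbad

lemma vNorm_eta_sub_le_pow (h : F.UniformDrift V δ B) (hd : 0 ≤ d)
    (hC : F.LocallyComparable (sublevel V d) e₁ e₂ ν) (hw : 1 - (e₁ / e₂) ^ 2 ≤ w) (hw0 : 0 < w)
    (hw1 : w ≤ 1) (hl : 0 < l) (hdl : Real.exp (-(δ * d)) ≤ (l ^ 2 / (2 * Real.exp (2 * B))) ^ 4)
    (hμ : MemP V μ) (hμ' : MemP V μ') (hK : 0 ≤ K) (hK' : 0 ≤ K') (hc : 0 < c) (hc' : 0 < c')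
    (hm : F.MassControl V μ l K c) (hm' : F.MassControl V μ' l K' c') (n : ℕ) :
    vNorm V ((F.eta μ n).toSignedMeasure - (F.eta μ' n).toSignedMeasure) ≤
      ENNReal.ofReal (max √w (1 / 2)) ^ n *
        ENNReal.ofReal (2 * (w⁻¹ * (K * K')) + 2 / (c * c')) *
          integralExp V μ * integralExp V μ' := by
  have hV := h.measurable_V
  have hA : 0 ≤ ∫ x, Real.exp (V x) ∂μ := integral_nonneg fun _ => (Real.exp_pos _).le
  rw [← ofReal_integral_exp hV hμ.2, ← ofReal_integral_exp hV hμ'.2, mul_assoc,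
    ← ENNReal.ofReal_mul hA, ← ENNReal.ofReal_pow (by positivity),
    ← ENNReal.ofReal_mul (by positivity), ← ENNReal.ofReal_mul (by positivity)]
  exact vNorm_toSignedMeasure_sub_le hV
    (h.integralExp_eta_lt_top hμ.2 ((mul_pos hc (pow_pos hl n)).trans_le (hm.mul_pow_le n)))
    (h.integralExp_eta_lt_top hμ'.2 ((mul_pos hc' (pow_pos hl n)).trans_le (hm'.mul_pow_le n)))
    fun f hf hfv => h.abs_integral_eta_sub_le_pow hd hC hw hw0 hw1 hl hdl hμ hμ' hK hK' hc hc'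
      hm hm' hf hfv n

end UniformDrift

end FeynmanKac

section Admissible

variable {X : Type*} [MeasurableSpace X] {F : FeynmanKac X} {V : X → ℝ} {δ dlow : ℝ}
  {b εm εp : ℝ → ℝ} {ν : ℝ → Measure X}

lemma DriftCondition.uniformDrift (h : DriftCondition F V δ dlow b) :
    F.UniformDrift V δ (max (b dlow) 0) where
  measurable_V := h.measurable_V
  nonneg_V x := zero_le_one.trans (h.one_le_V x)
  delta_pos := h.delta_pos
  drift n x := by
    refine (h.drift dlow le_rfl n x).trans (ENNReal.ofReal_le_ofReal (Real.exp_le_exp.2 ?_))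
    gcongr
    exact Set.indicator_apply_le' (fun _ => le_max_left _ _) fun _ => le_max_right _ _

lemma MinorizationCondition.localComparison (h : MinorizationCondition F V dlow εm ν)
    (h' : MajorizationCondition F V dlow εm εp ν) : F.LocalComparison V dlow εm εp ν where
  comparable d hd :=
    { lower_pos := h.eps_pos d hd
      upper_pos := (h.eps_pos d hd).trans_le (h'.eps_le d hd)
      isFiniteMeasure := have := (h.nu_mem d hd).1; inferInstance
      le_Q := fun n x hx => Measure.le_iff.2 fun A hA => by
        rw [Measure.smul_apply, Measure.restrict_apply hA, Measure.restrict_apply hA,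
          Set.inter_comm]
        exact h.minorization d hd n x hx A hA
      Q_le := fun n x hx => Measure.le_iff.2 fun A hA => by
        rw [Measure.smul_apply, Measure.restrict_apply hA, Measure.restrict_apply hA,
          Set.inter_comm]
        exact h'.majorization d hd n x hx A hA }
  nu_pos d hd := h.nu_pos d hd dlow le_rfl hd

end Admissible

theorem corollary1_general {X : Type*} [MeasurableSpace X] (V : X → ℝ) (δ dlow B : ℝ)
    (εm εp : ℝ → ℝ) (ν : ℝ → Measure X) :
    ∃ ρ : ℝ≥0, ρ < 1 ∧
      ∀ μ μ' : Measure X, MemP V μ → MemP V μ' →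
        ∃ c : ℝ≥0, ∀ F : FeynmanKac X, F.UniformDrift V δ B →
          F.LocalComparison V dlow εm εp ν →
            ∀ n : ℕ,
              vNorm V ((F.eta μ n).toSignedMeasure - (F.eta μ' n).toSignedMeasure) ≤
                (ρ : ℝ≥0∞) ^ n * c * integralExp V μ * integralExp V μ' := by
  by_cases hex : ∃ F : FeynmanKac X, F.UniformDrift V δ B ∧ F.LocalComparison V dlow εm εp ν
  swap
  · exact ⟨0, zero_lt_one, fun μ μ' _ _ => ⟨0, fun F h hF => (hex ⟨F, h, hF⟩).elim⟩⟩
  obtain ⟨F₀, h₀, hF₀⟩ := hex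
  have hrate {d : ℝ} (hd : dlow ≤ d) := hF₀.returnRate_pos hd
  have hl := hrate le_rfl
  obtain ⟨d, hd, hdl⟩ := ((Filter.eventually_ge_atTop (max dlow 0)).and
    (FeynmanKac.eventually_exp_neg_mul_le h₀.delta_pos
      (show 0 < (FeynmanKac.returnRate V dlow εm ν dlow ^ 2 / (2 * Real.exp (2 * B))) ^ 4 by
        positivity))).exists
  obtain ⟨hd, hd0⟩ := max_le_iff.1 hd
  have hC₀ := hF₀.comparable d hd
  obtain ⟨w, hw0, hw1, hw⟩ := FeynmanKac.exists_contraction_factor hC₀.lower_pos hC₀.upper_pos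
  refine ⟨(max √w (1 / 2)).toNNReal, ?_, fun μ μ' hμ hμ' => ?_⟩
  · have hsqrt : √w < 1 := (Real.sqrt_lt' one_pos).2 (by rwa [one_pow])
    exact Real.toNNReal_lt_one.2 (max_lt hsqrt (by norm_num))
  obtain ⟨K, c, hK, hc, hm⟩ :=
    FeynmanKac.exists_massControl h₀.delta_pos B εp (fun _ => hrate) hμ
  obtain ⟨K', c', hK', hc', hm'⟩ :=
    FeynmanKac.exists_massControl h₀.delta_pos B εp (fun _ => hrate) hμ'
  exact ⟨(2 * (w⁻¹ * (K * K')) + 2 / (c * c')).toNNReal, fun F h hF =>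
    h.vNorm_eta_sub_le_pow hd0 (hF.comparable d hd) hw hw0 hw1.le hl hdl hμ hμ' hK hK' hc hc'
      (hm F h hF) (hm' F h hF)⟩

theorem corollary1 {X : Type*} [TopologicalSpace X] [PolishSpace X] [MeasurableSpace X]
    [BorelSpace X] (V : X → ℝ) (δ dlow : ℝ) (b εm εp : ℝ → ℝ) (ν : ℝ → Measure X)
    (μ : Measure X) (hμ : InitialCondition V μ) :
    ∃ ρ : ℝ≥0, ρ < 1 ∧
      ∀ μ' : Measure X, MemP V μ' →
        ∃ c : ℝ≥0, ∀ F : FeynmanKac X,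
          DriftCondition F V δ dlow b →
          MinorizationCondition F V dlow εm ν →
          MajorizationCondition F V dlow εm εp ν →
            ∀ n : ℕ,
              vNorm V ((F.eta μ n).toSignedMeasure - (F.eta μ' n).toSignedMeasure) ≤
                (ρ : ℝ≥0∞) ^ n * c * integralExp V μ * integralExp V μ' := by
  obtain ⟨ρ, hρ, hbound⟩ := corollary1_general V δ dlow (max (b dlow) 0) εm εp ν
  exact ⟨ρ, hρ, fun μ' hμ' => (hbound μ μ' hμ hμ').imp fun _ hc F hd hm hM =>
    hc F hd.uniformDrift (hm.localComparison hM)⟩
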